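/- Let $n\ge 1$, $0\le\gamma<1$ and $\alpha=\frac{4}{3+\gamma}$. Let $\Omega\subset\mathbb R^n$ be a bounded domain (open connected set) and, for some $\delta>0$, let $\mathcal B:\mathbb R\to\mathbb R$ be a Lipschitz function with $0\le\mathcal B\le 1$ on $[0,\infty)$, $\mathcal B=0$ on $(-\infty,\delta/2]$ and $\mathcal B=1$ on $[\delta,\infty)$; for $\varepsilon>0$ put $\mathcal B_\varepsilon(s)=\mathcal B(s/\varepsilon^\alpha)$. Write $\Delta_\infty v=\sum_{i,j}D_{ij}v\,D_iv\,D_jv$. For boundary data $\varphi_\varepsilon\ge 0$ on $\partial\Omega$, consider the problem $$(P_\varepsilon)\qquad \Delta_\infty v=\mathcal B_\varepsilon(v)\,v^{-\gamma}\ \text{ in }\Omega,\qquad v=\varphi_\varepsilon\ \text{ on }\partial\Omega,$$ where the right-hand side is read as $0$ wherever $v\le 0$ and the equation is understood in the viscosity sense. The minimal solution of $(P_\varepsilon)$ is the viscosity solution $u_\varepsilon\in C(\overline\Omega)$ that satisfies $u_\varepsilon\le w$ for every viscosity supersolution $w\in C(\overline\Omega)$ of the equation with $w=\varphi_\varepsilon$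 on $\partial\Omega$. A function $u:\overline\Omega\to\mathbb R$ with $u=\varphi$ on $\partial\Omega$ is called a limit solution if there are $\varepsilon_k\to0^+$ and boundary data $\varphi_{\varepsilon_k}\ge 0$ with $\varphi_{\varepsilon_k}\to\varphi$ pointwise on $\partial\Omega$ such that the minimal solutions $u_{\varepsilon_k}$ of $(P_{\varepsilon_k})$ exist and converge to $u$ locally uniformly in $\Omega$. **Proposition.** For all $n\ge1$, $0\le\gamma<1$, $M\ge 0$ and $d>0$ there exist constants $C>0$ and $r_0>0$, depending only on $n,\gamma,M,d$, such that the following holds for all $\delta,\mathcal B,\Omega,\varphi$ as above, every limit solution $u$ with $\|u\|_{L^\infty(\Omega)}\le M$, and every subdomain $\Omega'\Subset\Omega$ with $\operatorname{dist}(\Omega',\partial\Omega)\ge d$: for every $0<r\le r_0$ and every $$x\in\overline{\{y\in\Omega: u(y)<r^\alpha\}}\cap\Omega'$$ one has $B_r(x)\subset\Omega$ and $$\sup_{B_r(x)}u\le C\,r^\alpha .$$ -/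

import Mathlib

open Set Filter Topology MeasureTheory
open scoped ENNReal

noncomputable section

namespace SingularInfinity

/-- The exponent `α = 4 / (3 + γ)`. -/
def alpha (γ : ℝ) : ℝ := 4 / (3 + γ)

/-- The infinity Laplacian `∑ i j, D_ij ψ D_i ψ D_j ψ = ⟨D²ψ Dψ, Dψ⟩` of a function on `ℝⁿ`. -/
def infinityLaplacian {n : ℕ} (ψ : EuclideanSpace ℝ (Fin n) → ℝ)
    (x : EuclideanSpace ℝ (Fin n)) : ℝ :=
  fderiv ℝ (fderiv ℝ ψ) x (gradient ψ x) (gradient ψ x)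

/-- `u` is a viscosity subsolution of `Δ_∞ u = f(u)` in the open set `Ω`: whenever a `C²` function
`ψ` touches `u` from above at a point of `Ω`, one has `Δ_∞ ψ ≥ f(u)` there. -/
def IsViscositySubsolution {n : ℕ} (f : ℝ → ℝ) (Ω : Set (EuclideanSpace ℝ (Fin n)))
    (u : EuclideanSpace ℝ (Fin n) → ℝ) : Prop :=
  ∀ x ∈ Ω, ∀ ψ : EuclideanSpace ℝ (Fin n) → ℝ, ContDiffAt ℝ 2 ψ x →
    IsLocalMax (fun y => u y - ψ y) x → f (u x) ≤ infinityLaplacian ψ x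

/-- `u` is a viscosity supersolution of `Δ_∞ u = f(u)` in the open set `Ω`: whenever a `C²` function
`ψ` touches `u` from below at a point of `Ω`, one has `Δ_∞ ψ ≤ f(u)` there. -/
def IsViscositySupersolution {n : ℕ} (f : ℝ → ℝ) (Ω : Set (EuclideanSpace ℝ (Fin n)))
    (u : EuclideanSpace ℝ (Fin n) → ℝ) : Prop :=
  ∀ x ∈ Ω, ∀ ψ : EuclideanSpace ℝ (Fin n) → ℝ, ContDiffAt ℝ 2 ψ x →
    IsLocalMin (fun y => u y - ψ y) x → infinityLaplacian ψ x ≤ f (u x)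

/-- The profile `𝓑` of the penalization: a Lipschitz function with `0 ≤ 𝓑 ≤ 1` on `[0, ∞)`,
`𝓑 = 0` on `(-∞, δ/2]` and `𝓑 = 1` on `[δ, ∞)`. -/
structure IsPenalization (δ : ℝ) (B : ℝ → ℝ) : Prop where
  lipschitz : ∃ K, LipschitzWith K B
  mem_Icc : ∀ s, 0 ≤ s → B s ∈ Icc (0 : ℝ) 1
  eq_zero : ∀ s, s ≤ δ / 2 → B s = 0
  eq_one : ∀ s, δ ≤ s → B s = 1

/-- The source term `𝓑_ε(s) s^{-γ}`, where `𝓑_ε(s) = 𝓑(s / ε^α)`. For a penalization profile `𝓑`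
and `ε > 0` it vanishes for all `s ≤ (δ/2) ε^α`, so the values given to `s ^ (-γ)` at `s ≤ 0`
play no role. -/
def source (γ : ℝ) (B : ℝ → ℝ) (ε s : ℝ) : ℝ :=
  B (s / ε ^ alpha γ) * s ^ (-γ)

/-- The class of competitors: functions `w ∈ C(closure Ω)` with `w = φ` on `∂Ω` that are viscosity
supersolutions of `Δ_∞ w = f(w)` in `Ω`. -/
structure IsCompetitor {n : ℕ} (f : ℝ → ℝ) (Ω : Set (EuclideanSpace ℝ (Fin n)))
    (φ w : EuclideanSpace ℝ (Fin n) → ℝ) : Prop where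
  continuousOn : ContinuousOn w (closure Ω)
  boundary : ∀ x ∈ frontier Ω, w x = φ x
  supersolution : IsViscositySupersolution f Ω w

/-- `v` is the minimal (Perron) viscosity solution in `C(closure Ω)` of the Dirichlet problem
`Δ_∞ v = f(v)` in `Ω`, `v = φ` on `∂Ω`: it is a viscosity solution with these boundary values,
and it is the smallest of all supersolutions with these boundary values. -/
structure IsMinimalSolution {n : ℕ} (f : ℝ → ℝ) (Ω : Set (EuclideanSpace ℝ (Fin n)))
    (φ v : EuclideanSpace ℝ (Fin n) → ℝ) : Prop where
  isCompetitor : IsCompetitor f Ω φ v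
  subsolution : IsViscositySubsolution f Ω v
  minimal : ∀ w, IsCompetitor f Ω φ w → ∀ x ∈ closure Ω, v x ≤ w x

/-- `u` is a limit solution with boundary values `φ`: the locally uniform limit in `Ω` of minimal
solutions `v k` of `Δ_∞ v = 𝓑_ε(v) v^{-γ}` in `Ω`, `v = φ_ε` on `∂Ω`, along some sequence of
parameters `ε = ε k → 0⁺`, the boundary data `φ_ε = φ' k ≥ 0` converging to `φ` on `∂Ω`. -/
def IsLimitSolution {n : ℕ} (γ : ℝ) (B : ℝ → ℝ) (Ω : Set (EuclideanSpace ℝ (Fin n)))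
    (φ u : EuclideanSpace ℝ (Fin n) → ℝ) : Prop :=
  (∀ x ∈ frontier Ω, u x = φ x) ∧
  ∃ (ε : ℕ → ℝ) (φ' v : ℕ → EuclideanSpace ℝ (Fin n) → ℝ),
    (∀ k, 0 < ε k) ∧ Tendsto ε atTop (𝓝 0) ∧
    (∀ k, ∀ x ∈ frontier Ω, 0 ≤ φ' k x) ∧
    (∀ x ∈ frontier Ω, Tendsto (fun k => φ' k x) atTop (𝓝 (φ x))) ∧
    (∀ k, IsMinimalSolution (source γ B (ε k)) Ω (φ' k) (v k)) ∧
    TendstoLocallyUniformlyOn v u atTop Ω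

end SingularInfinity

end

/-!
The radial function `A (m - |p - q|) ^ α`, `α = 4 / (3 + γ)`, solves `Δ_∞ ψ = c(A) ψ ^ (-γ)` off
`q`, where `c(A) → ∞` as `A → ∞`. For `c(A) > 2` it therefore cannot touch a positive supersolution
of `Δ_∞ w = 2 w ^ (-γ)` from below away from `q`, so `(w / A) ^ (1 / α)` decreases by at most
`|p - q|` from `q` to a nearby point `p`. The supersolutions approximating a limit solution are
nonnegative, and shifting them up by `(δ / 2) ε ^ α` makes them positive supersolutions of this
equation. In the limit, `(u / A) ^ (1 / α)` is locally `1`-Lipschitz, and this is the claimed growth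
of `u` at rate `r ^ α`.
-/

namespace SingularInfinity

section NormedSpace

lemma ball_subset_of_le_dist_frontier {E : Type*} [NormedAddCommGroup E] [NormedSpace ℝ E]
    [FiniteDimensional ℝ E] {s : Set E} {x : E} {d : ℝ} (hx : x ∈ s)
    (h : ∀ y ∈ frontier s, d ≤ dist x y) : Metric.ball x d ⊆ s := by
  rcases eq_or_ne s univ with rfl | hs
  · exact subset_univ _
  · obtain ⟨y, hy, hxy⟩ := exists_mem_frontier_infDist_compl_eq_dist hx hs
    exact (Metric.ball_subset_ball (hxy ▸ h y hy)).trans Metric.ball_infDist_compl_subset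

lemma le_of_eLpNorm_top_le {X : Type*} [TopologicalSpace X] [MeasurableSpace X]
    {μ : Measure X} [μ.IsOpenPosMeasure] {U : Set X} (hU : IsOpen U) {f : X → ℝ}
    (hf : ContinuousOn f U) {M : ℝ} (hM : 0 ≤ M)
    (h : eLpNorm f ∞ (μ.restrict U) ≤ ENNReal.ofReal M) : ∀ x ∈ U, f x ≤ M := by
  rw [eLpNorm_exponent_top] at h
  have hae : (fun x => max (f x) M) =ᵐ[μ.restrict U] fun _ => M := by
    filter_upwards [ae_le_eLpNormEssSup (f := f) (μ := μ.restrict U)] with x hx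
    have hnorm : ‖f x‖ ≤ M := by
      rw [← ENNReal.ofReal_le_ofReal_iff hM, ofReal_norm]
      exact hx.trans h
    exact max_eq_right ((le_abs_self _).trans hnorm)
  intro x hx
  exact max_eq_right_iff.1
    (Measure.eqOn_open_of_ae_eq hae hU (hf.sup continuousOn_const) continuousOn_const hx)

variable {E : Type*} [NormedAddCommGroup E] [InnerProductSpace ℝ E]

lemma hasFDerivAt_norm_sub {p q : E} (hp : p ≠ q) :
    HasFDerivAt (fun p => ‖p - q‖) (‖p - q‖⁻¹ • innerSL ℝ (p - q)) p := by
  have hpos : 0 < ‖p - q‖ := norm_sub_pos_iff.2 hp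
  have hsqrt := (((hasFDerivAt_id p).sub_const q).norm_sq).sqrt (by simpa using hpos.ne')
  simp only [id, Real.sqrt_sq (norm_nonneg _)] at hsqrt
  refine hsqrt.congr_fderiv ?_
  ext v
  simp only [smul_apply, smul_eq_mul, nsmul_eq_mul, ContinuousLinearMap.comp_id]
  field_simp
  norm_num

lemma hasFDerivAt_comp_norm_sub {g : ℝ → ℝ} {g' : ℝ} {p q : E} (hp : p ≠ q)
    (hg : HasDerivAt g g' ‖p - q‖) :
    HasFDerivAt (fun p => g ‖p - q‖) ((g' / ‖p - q‖) • innerSL ℝ (p - q)) p :=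
  (hg.comp_hasFDerivAt p (hasFDerivAt_norm_sub hp)).congr_fderiv (by
    rw [smul_smul, div_eq_mul_inv])

end NormedSpace

section Radial

variable {n : ℕ}

lemma infinityLaplacian_radial {g g₁ : ℝ → ℝ} {g₂ : ℝ} {p q : EuclideanSpace ℝ (Fin n)}
    (hp : p ≠ q) (hg : ∀ᶠ s in 𝓝 ‖p - q‖, HasDerivAt g (g₁ s) s)
    (hg₁ : HasDerivAt g₁ g₂ ‖p - q‖) :
    infinityLaplacian (fun p => g ‖p - q‖) p = g₂ * g₁ ‖p - q‖ ^ 2 := by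
  have hR : ‖p - q‖ ≠ 0 := (norm_sub_pos_iff.2 hp).ne'
  have hgrad : gradient (fun p => g ‖p - q‖) p = (g₁ ‖p - q‖ / ‖p - q‖) • (p - q) := by
    refine HasGradientAt.gradient ((hasFDerivAt_comp_norm_sub hp hg.self_of_nhds).congr_fderiv ?_)
    ext v
    simp [InnerProductSpace.toDual_apply_apply]
  have hfderiv : fderiv ℝ (fun p => g ‖p - q‖) =ᶠ[𝓝 p]
      fun p => (g₁ ‖p - q‖ / ‖p - q‖) • innerSL ℝ (p - q) := by
    have hcont : ContinuousAt (fun p => ‖p - q‖) p := by fun_prop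
    filter_upwards [hcont.eventually hg, isOpen_ne.mem_nhds hp] with y hgy hy
    exact (hasFDerivAt_comp_norm_sub hy hgy).fderiv
  let I : EuclideanSpace ℝ (Fin n) →L[ℝ] EuclideanSpace ℝ (Fin n) →L[ℝ] ℝ := innerSL ℝ
  have hhess : HasFDerivAt (fun p => (g₁ ‖p - q‖ / ‖p - q‖) • I (p - q))
      ((g₁ ‖p - q‖ / ‖p - q‖) • I +
        (((g₂ * ‖p - q‖ - g₁ ‖p - q‖ * 1) / ‖p - q‖ ^ 2 / ‖p - q‖) •
          I (p - q)).smulRight (I (p - q))) p :=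
    (hasFDerivAt_comp_norm_sub hp (hg₁.div (hasDerivAt_id _) hR)).smul
      (I.hasFDerivAt.comp p ((hasFDerivAt_id p).sub_const q))
  have hI : I (p - q) (p - q) = ‖p - q‖ ^ 2 := real_inner_self_eq_norm_sq (p - q)
  rw [infinityLaplacian, hgrad, (hhess.congr_of_eventuallyEq hfderiv).fderiv]
  simp only [map_smul, add_apply, smul_apply, ContinuousLinearMap.smulRight_apply, hI, smul_eq_mul]
  field_simp
  ring

end Radial

section Barrier

variable {n : ℕ} {γ A : ℝ}

lemma alpha_pos (hγ : -3 < γ) : 0 < alpha γ :=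
  div_pos four_pos (by linarith)

lemma one_lt_alpha (hγ : -3 < γ) (hγ1 : γ < 1) : 1 < alpha γ := by
  rw [alpha, lt_div_iff₀ (by linarith)]
  linarith

lemma alpha_mul_three_add (hγ : -3 < γ) : alpha γ * (3 + γ) = 4 :=
  div_mul_cancel₀ _ (by linarith)

/-- The inverse on `[0, ∞)` of the barrier profile `t ↦ A t ^ α`. It linearizes the expected growth:
growth of `u` at rate `r ^ α` is a Lipschitz estimate for `profileInv γ A ∘ u`. -/
noncomputable def profileInv (γ A s : ℝ) : ℝ := (s / A) ^ (alpha γ)⁻¹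

lemma profileInv_pos (hA : 0 < A) {s : ℝ} (hs : 0 < s) : 0 < profileInv γ A s :=
  Real.rpow_pos_of_pos (div_pos hs hA) _

lemma profileInv_le_iff (hγ : -3 < γ) (hA : 0 < A) {s t : ℝ} (hs : 0 ≤ s) (ht : 0 ≤ t) :
    profileInv γ A s ≤ t ↔ s ≤ A * t ^ alpha γ := by
  rw [profileInv, Real.rpow_inv_le_iff_of_pos (by positivity) ht (alpha_pos hγ), div_le_iff₀' hA]

lemma le_profileInv_iff (hγ : -3 < γ) (hA : 0 < A) {s t : ℝ} (hs : 0 ≤ s) (ht : 0 ≤ t) :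
    t ≤ profileInv γ A s ↔ A * t ^ alpha γ ≤ s := by
  rw [profileInv, Real.le_rpow_inv_iff_of_pos ht (by positivity) (alpha_pos hγ), le_div_iff₀' hA]

lemma mul_profileInv_rpow (hγ : -3 < γ) (hA : 0 < A) {s : ℝ} (hs : 0 ≤ s) :
    A * profileInv γ A s ^ alpha γ = s := by
  rw [profileInv, Real.rpow_inv_rpow (by positivity) (alpha_pos hγ).ne', mul_div_cancel₀ _ hA.ne']

lemma continuous_profileInv (hγ : -3 < γ) : Continuous (profileInv γ A) :=
  (continuous_id.div_const A).rpow_const fun _ => Or.inr (inv_nonneg.2 (alpha_pos hγ).le)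

/-- The radial barrier `A (m - |p - q|) ^ α` centred at `q`, meaningful where `|p - q| < m`. -/
noncomputable def barrier (γ A m : ℝ) (q p : EuclideanSpace ℝ (Fin n)) : ℝ :=
  A * (m - ‖p - q‖) ^ alpha γ

lemma hasDerivAt_const_mul_sub_rpow (a β : ℝ) {m s : ℝ} (hs : s < m) :
    HasDerivAt (fun s => a * (m - s) ^ β) (-(a * β) * (m - s) ^ (β - 1)) s := by
  refine ((((hasDerivAt_id s).const_sub m).rpow_const
    (Or.inl (sub_pos.2 hs).ne')).const_mul a).congr_deriv ?_
  simp only [id]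
  ring

lemma contDiffAt_barrier {m : ℝ} {p q : EuclideanSpace ℝ (Fin n)} (hp : p ≠ q)
    (hm : ‖p - q‖ < m) : ContDiffAt ℝ 2 (barrier γ A m q) p :=
  contDiffAt_const.mul ((contDiffAt_const.sub
    ((contDiffAt_id.sub contDiffAt_const).norm ℝ (sub_ne_zero.2 hp))).rpow_const_of_ne
      (sub_pos.2 hm).ne')

lemma infinityLaplacian_barrier (hγ : -3 < γ) (hA : 0 < A) {m : ℝ}
    {p q : EuclideanSpace ℝ (Fin n)} (hp : p ≠ q) (hm : ‖p - q‖ < m) :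
    infinityLaplacian (barrier γ A m q) p =
      A ^ (3 + γ) * (alpha γ ^ 3 * (alpha γ - 1)) * barrier γ A m q p ^ (-γ) := by
  have hradial := infinityLaplacian_radial hp
    ((eventually_lt_nhds hm).mono fun s hs => hasDerivAt_const_mul_sub_rpow A (alpha γ) hs)
    (hasDerivAt_const_mul_sub_rpow (-(A * alpha γ)) (alpha γ - 1) hm)
  unfold barrier
  rw [hradial]
  have ht : 0 < m - ‖p - q‖ := sub_pos.2 hm
  set α := alpha γ
  set t := m - ‖p - q‖
  have ht_pow : t ^ (α - 1 - 1) * (t ^ (α - 1)) ^ 2 = (t ^ α) ^ (-γ) := by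
    rw [← Real.rpow_mul_natCast ht.le, ← Real.rpow_add ht, ← Real.rpow_mul ht.le]
    congr 1
    push_cast
    linarith [alpha_mul_three_add hγ]
  have hA_pow : A ^ 3 = A ^ (3 + γ) * A ^ (-γ) := by
    rw [← Real.rpow_add hA, ← Real.rpow_natCast]
    congr 1
    push_cast
    ring
  calc _ = A ^ 3 * (α ^ 3 * (α - 1)) * (t ^ (α - 1 - 1) * (t ^ (α - 1)) ^ 2) := by ring
    _ = _ := by
      rw [ht_pow, hA_pow, Real.mul_rpow hA.le (Real.rpow_nonneg ht.le _)]
      ring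

lemma exists_barrier_const (hγ : -3 < γ) (hγ1 : γ < 1) (c M : ℝ) {ρ : ℝ} (hρ : 0 < ρ) :
    ∃ A : ℝ, 1 ≤ A ∧ c < A ^ (3 + γ) * (alpha γ ^ 3 * (alpha γ - 1)) ∧ M < A * ρ ^ alpha γ := by
  have hc : 0 < alpha γ ^ 3 * (alpha γ - 1) :=
    mul_pos (pow_pos (alpha_pos hγ) 3) (sub_pos.2 (one_lt_alpha hγ hγ1))
  have hpow : Tendsto (fun A : ℝ => A ^ (3 + γ) * (alpha γ ^ 3 * (alpha γ - 1))) atTop atTop :=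
    (tendsto_rpow_atTop (by linarith)).atTop_mul_const hc
  have hlin : Tendsto (fun A : ℝ => A * ρ ^ alpha γ) atTop atTop :=
    tendsto_id.atTop_mul_const (Real.rpow_pos_of_pos hρ _)
  exact ((eventually_ge_atTop 1).and
    ((hpow.eventually_gt_atTop c).and (hlin.eventually_gt_atTop M))).exists

end Barrier

namespace IsViscositySupersolution

variable {n : ℕ} {f g : ℝ → ℝ} {γ A c ρ : ℝ} {Ω U : Set (EuclideanSpace ℝ (Fin n))}
  {q : EuclideanSpace ℝ (Fin n)} {v w ψ : EuclideanSpace ℝ (Fin n) → ℝ}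

lemma add_const (hv : IsViscositySupersolution f Ω v) (hU : U ⊆ Ω)
    (hfg : ∀ x ∈ U, f (v x) ≤ g (v x + c)) :
    IsViscositySupersolution g U (fun x => v x + c) := by
  intro x hx ψ hψ hmin
  refine (hv x (hU hx) ψ hψ ?_).trans (hfg x hx)
  filter_upwards [hmin] with p hp
  linarith

lemma ge_of_infinityLaplacian_pos (hv : IsViscositySupersolution f Ω v)
    (hf : ∀ s < 0, f s ≤ 0) (hΩ : IsOpen Ω) (hΩb : Bornology.IsBounded Ω)
    (hvc : ContinuousOn v (closure Ω)) (hv0 : ∀ x ∈ frontier Ω, 0 ≤ v x)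
    (hψc : ContinuousOn ψ (closure Ω)) (hψ0 : ∀ x ∈ closure Ω, ψ x ≤ 0)
    (hψ : ∀ x ∈ Ω, ContDiffAt ℝ 2 ψ x) (hψΔ : ∀ x ∈ Ω, 0 < infinityLaplacian ψ x) :
    ∀ x ∈ Ω, ψ x ≤ v x := by
  by_contra! hcon
  obtain ⟨x, hx, hvx⟩ := hcon
  obtain ⟨z, hz, hmin⟩ := hΩb.isCompact_closure.exists_isMinOn ⟨x, subset_closure hx⟩
    (hvc.sub hψc)
  have hzx : v z - ψ z ≤ v x - ψ x := hmin (subset_closure hx)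
  have hvz : v z < 0 := by linarith [hψ0 z hz]
  have hzΩ : z ∈ Ω := by
    by_contra hz_notMem
    exact (hv0 z (hΩ.frontier_eq ▸ ⟨hz, hz_notMem⟩)).not_gt hvz
  have hloc : IsLocalMin (fun y => v y - ψ y) z :=
    (hmin.on_subset subset_closure).isLocalMin (hΩ.mem_nhds hzΩ)
  exact ((hv z hzΩ ψ (hψ z hzΩ) hloc).trans (hf _ hvz)).not_gt (hψΔ z hzΩ)

lemma nonneg (hv : IsViscositySupersolution f Ω v) (hn : 1 ≤ n) (hf : ∀ s < 0, f s ≤ 0)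
    (hΩ : IsOpen Ω) (hΩb : Bornology.IsBounded Ω) (hvc : ContinuousOn v (closure Ω))
    (hv0 : ∀ x ∈ frontier Ω, 0 ≤ v x) : ∀ x ∈ Ω, 0 ≤ v x := by
  have : Nonempty (Fin n) := ⟨⟨0, hn⟩⟩
  obtain ⟨R, hR⟩ := hΩb.closure.subset_closedBall (0 : EuclideanSpace ℝ (Fin n))
  obtain ⟨q, hq⟩ := NormedSpace.exists_lt_norm ℝ (EuclideanSpace ℝ (Fin n)) R
  have hqΩ : ∀ z ∈ closure Ω, z ≠ q := by
    rintro z hz rfl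
    exact (mem_closedBall_zero_iff.1 (hR hz)).not_gt hq
  obtain ⟨S, hS⟩ := hΩb.isCompact_closure.bddAbove_image
    (f := fun z => ‖z - q‖ ^ 2) (by fun_prop)
  have hS' : ∀ z ∈ closure Ω, ‖z - q‖ ^ 2 ≤ S := fun z hz => hS (mem_image_of_mem _ hz)
  have hlower : ∀ κ > 0, ∀ x ∈ Ω, κ * (‖x - q‖ ^ 2 - S) ≤ v x := by
    intro κ hκ
    refine hv.ge_of_infinityLaplacian_pos hf hΩ hΩb hvc hv0 (by fun_prop)
      (fun z hz => mul_nonpos_of_nonneg_of_nonpos hκ.le (sub_nonpos.2 (hS' z hz)))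
      (fun z _ => contDiffAt_const.mul
        (((contDiffAt_id.sub contDiffAt_const).norm_sq ℝ).sub contDiffAt_const)) fun z hz => ?_
    have hpos : 0 < ‖z - q‖ := norm_sub_pos_iff.2 (hqΩ z (subset_closure hz))
    rw [infinityLaplacian_radial (g := fun s => κ * (s ^ 2 - S)) (g₁ := fun s => κ * (2 * s))
      (g₂ := κ * 2) (hqΩ z (subset_closure hz))
      (Eventually.of_forall fun s => by
        simpa using ((hasDerivAt_pow 2 s).sub_const S).const_mul κ)
      (by simpa using ((hasDerivAt_id ‖z - q‖).const_mul 2).const_mul κ)]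
    positivity
  intro x hx
  have hlim : Tendsto (fun κ : ℝ => κ * (‖x - q‖ ^ 2 - S)) (𝓝[>] 0) (𝓝 0) := by
    refine Tendsto.mono_left ?_ nhdsWithin_le_nhds
    simpa using (continuous_id.mul_const (‖x - q‖ ^ 2 - S)).tendsto (0 : ℝ)
  exact le_of_tendsto hlim (eventually_mem_nhdsWithin.mono fun κ hκ => hlower κ hκ x hx)

lemma barrier_not_isLocalMin {m : ℝ} {z : EuclideanSpace ℝ (Fin n)}
    (hw : IsViscositySupersolution (fun s => c * s ^ (-γ)) Ω w) (hγ : -3 < γ) (hA : 0 < A)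
    (hAc : c < A ^ (3 + γ) * (alpha γ ^ 3 * (alpha γ - 1))) (hz : z ∈ Ω) (hzq : z ≠ q)
    (hzm : ‖z - q‖ < m) (hwz : w z = barrier γ A m q z) :
    ¬ IsLocalMin (fun p => w p - barrier γ A m q p) z := by
  intro hloc
  have hle := hw z hz _ (contDiffAt_barrier hzq hzm) hloc
  rw [infinityLaplacian_barrier hγ hA hzq hzm, hwz] at hle
  have hbarrier : 0 < barrier γ A m q z ^ (-γ) :=
    Real.rpow_pos_of_pos (mul_pos hA (Real.rpow_pos_of_pos (sub_pos.2 hzm) _)) _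
  exact hAc.not_ge (le_of_mul_le_mul_right hle hbarrier)

lemma profileInv_le_add_dist
    (hw : IsViscositySupersolution (fun s => c * s ^ (-γ)) (Metric.ball q ρ) w) (hγ : -3 < γ)
    (hA : 0 < A) (hAc : c < A ^ (3 + γ) * (alpha γ ^ 3 * (alpha γ - 1)))
    (hcont : ContinuousOn w (Metric.closedBall q ρ))
    (hpos : ∀ z ∈ Metric.closedBall q ρ, 0 < w z) (hq : w q < A * ρ ^ alpha γ) :
    ∀ x ∈ Metric.closedBall q ρ,
      profileInv γ A (w q) ≤ profileInv γ A (w x) + dist x q := by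
  by_contra! hcon
  obtain ⟨x, hx, hxq⟩ := hcon
  have hρ : 0 ≤ ρ := dist_nonneg.trans hx
  have hq_mem : q ∈ Metric.closedBall q ρ := Metric.mem_closedBall_self hρ
  have hq_lt : profileInv γ A (w q) < ρ :=
    lt_iff_lt_of_le_iff_le (le_profileInv_iff hγ hA (hpos q hq_mem).le hρ) |>.2 hq
  obtain ⟨z, hz, hmin⟩ := (isCompact_closedBall q ρ).exists_isMinOn ⟨q, hq_mem⟩
    (((continuous_profileInv hγ).comp_continuousOn hcont).add
      (by fun_prop : ContinuousOn (fun z => dist z q) (Metric.closedBall q ρ)))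
  set m := profileInv γ A (w z) + ‖z - q‖ with hm
  have hm_le : ∀ p ∈ Metric.closedBall q ρ, m ≤ profileInv γ A (w p) + ‖p - q‖ := fun p hp => by
    rw [hm, ← dist_eq_norm, ← dist_eq_norm]
    exact hmin hp
  have hm_lt : m < profileInv γ A (w q) :=
    (hm_le x hx).trans_lt (by rwa [← dist_eq_norm])
  have hzq : z ≠ q := by
    rintro rfl
    simp [hm] at hm_lt
  have hzm : ‖z - q‖ < m := lt_add_of_pos_left _ (profileInv_pos hA (hpos z hz))
  have hz_ball : z ∈ Metric.ball q ρ := by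
    rw [Metric.mem_ball, dist_eq_norm]
    linarith
  have hwz : w z = barrier γ A m q z := by
    rw [barrier, hm, add_sub_cancel_right, mul_profileInv_rpow hγ hA (hpos z hz).le]
  refine hw.barrier_not_isLocalMin hγ hA hAc hz_ball hzq hzm hwz ?_
  have hnear : ∀ᶠ p in 𝓝 z, ‖p - q‖ < m :=
    (by fun_prop : ContinuousAt (fun p => ‖p - q‖) z).eventually (eventually_lt_nhds hzm)
  filter_upwards [Metric.isOpen_ball.mem_nhds hz_ball, hnear] with p hp hpm
  have hp_mem := Metric.ball_subset_closedBall hp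
  have hbelow : barrier γ A m q p ≤ w p :=
    (le_profileInv_iff hγ hA (hpos p hp_mem).le (sub_pos.2 hpm).le).1
      (sub_le_iff_le_add.2 (hm_le p hp_mem))
  linarith

end IsViscositySupersolution

section Source

variable {γ δ ε s : ℝ} {B : ℝ → ℝ}

lemma source_eq_zero (hB : IsPenalization δ B) (hε : 0 < ε)
    (hs : s ≤ δ / 2 * ε ^ alpha γ) : source γ B ε s = 0 := by
  rw [source, hB.eq_zero _ ((div_le_iff₀ (Real.rpow_pos_of_pos hε _)).2 hs), zero_mul]

lemma rpow_neg_le_two_mul_add_rpow_neg {η : ℝ} (hγ1 : γ ≤ 1) (hη : 0 < η) (hs : η < s) :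
    s ^ (-γ) ≤ 2 * (s + η) ^ (-γ) := by
  have hs0 : 0 < s := hη.trans hs
  have hratio : ((s + η) / s) ^ γ ≤ 2 := calc
    ((s + η) / s) ^ γ ≤ ((s + η) / s) ^ (1 : ℝ) :=
      Real.rpow_le_rpow_of_exponent_le ((one_le_div hs0).2 (by linarith)) hγ1
    _ ≤ 2 := by
      rw [Real.rpow_one, div_le_iff₀ hs0]
      linarith
  rw [Real.div_rpow (by positivity) hs0.le, div_le_iff₀ (Real.rpow_pos_of_pos hs0 _)] at hratio
  rw [Real.rpow_neg hs0.le, Real.rpow_neg (by positivity), ← div_eq_mul_inv,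
    inv_le_comm₀ (by positivity) (by positivity), inv_div, div_le_iff₀' two_pos]
  exact hratio

lemma source_le (hγ1 : γ ≤ 1) (hδ : 0 < δ) (hB : IsPenalization δ B) (hε : 0 < ε)
    (hs : 0 ≤ s) : source γ B ε s ≤ 2 * (s + δ / 2 * ε ^ alpha γ) ^ (-γ) := by
  have hη : 0 < δ / 2 * ε ^ alpha γ := by positivity
  rcases le_or_gt s (δ / 2 * ε ^ alpha γ) with hs_le | hs_gt
  · rw [source_eq_zero hB hε hs_le]
    positivity
  · calc source γ B ε s ≤ s ^ (-γ) :=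
          mul_le_of_le_one_left (Real.rpow_nonneg hs _) (hB.mem_Icc _ (by positivity)).2
      _ ≤ _ := rpow_neg_le_two_mul_add_rpow_neg hγ1 hη hs_gt

end Source

/-- `u` is a locally uniform limit in `Ω` of nonnegative continuous supersolutions of the penalized
equations, along parameters `ε → 0⁺`: the one-sided part of a limit solution. -/
def IsSupersolutionLimit {n : ℕ} (γ : ℝ) (B : ℝ → ℝ) (Ω : Set (EuclideanSpace ℝ (Fin n)))
    (u : EuclideanSpace ℝ (Fin n) → ℝ) : Prop :=
  ∃ (ε : ℕ → ℝ) (v : ℕ → EuclideanSpace ℝ (Fin n) → ℝ),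
    (∀ k, 0 < ε k) ∧ Tendsto ε atTop (𝓝 0) ∧
    (∀ k, ContinuousOn (v k) Ω) ∧ (∀ k, ∀ x ∈ Ω, 0 ≤ v k x) ∧
    (∀ k, IsViscositySupersolution (source γ B (ε k)) Ω (v k)) ∧
    TendstoLocallyUniformlyOn v u atTop Ω

section Limit

variable {n : ℕ} {γ δ : ℝ} {B : ℝ → ℝ} {Ω : Set (EuclideanSpace ℝ (Fin n))}
  {φ u : EuclideanSpace ℝ (Fin n) → ℝ}

lemma IsLimitSolution.isSupersolutionLimit (hu : IsLimitSolution γ B Ω φ u) (hn : 1 ≤ n)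
    (hδ : 0 < δ) (hB : IsPenalization δ B) (hΩ : IsOpen Ω) (hΩb : Bornology.IsBounded Ω) :
    IsSupersolutionLimit γ B Ω u := by
  obtain ⟨-, ε, φ', v, hε, hε0, hφ', -, hmin, hlim⟩ := hu
  have hv k := (hmin k).isCompetitor
  have hsource : ∀ k, ∀ s < 0, source γ B (ε k) s ≤ 0 := fun k s hs => by
    have hεk := hε k
    exact (source_eq_zero hB hεk (hs.le.trans (by positivity))).le
  exact ⟨ε, v, hε, hε0, fun k => (hv k).continuousOn.mono subset_closure,
    fun k => (hv k).supersolution.nonneg hn (hsource k) hΩ hΩb (hv k).continuousOn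
      fun x hx => (hv k).boundary x hx ▸ hφ' k x hx,
    fun k => (hv k).supersolution, hlim⟩

namespace IsSupersolutionLimit

lemma continuousOn (hu : IsSupersolutionLimit γ B Ω u) : ContinuousOn u Ω := by
  obtain ⟨ε, v, -, -, hcont, -, -, hlim⟩ := hu
  exact hlim.continuousOn (Frequently.of_forall hcont)

lemma nonneg (hu : IsSupersolutionLimit γ B Ω u) : ∀ x ∈ Ω, 0 ≤ u x := by
  obtain ⟨ε, v, -, -, -, hv0, -, hlim⟩ := hu
  exact fun x hx => ge_of_tendsto' (hlim.tendsto_at hx) fun k => hv0 k x hx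

lemma profileInv_le_add_dist (hu : IsSupersolutionLimit γ B Ω u) (hγ : -3 < γ) (hγ1 : γ ≤ 1)
    (hδ : 0 < δ) (hB : IsPenalization δ B) {A ρ : ℝ} (hA : 0 < A)
    (hAc : 2 < A ^ (3 + γ) * (alpha γ ^ 3 * (alpha γ - 1))) {x y : EuclideanSpace ℝ (Fin n)}
    (hball : Metric.closedBall y ρ ⊆ Ω) (hy : u y < A * ρ ^ alpha γ)
    (hx : x ∈ Metric.closedBall y ρ) :
    profileInv γ A (u y) ≤ profileInv γ A (u x) + dist x y := by
  obtain ⟨ε, v, hε, hε0, hcont, hv0, hv, hlim⟩ := hu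
  have hyΩ : y ∈ Ω := hball (Metric.mem_closedBall_self (dist_nonneg.trans hx))
  have hshift : Tendsto (fun k => δ / 2 * ε k ^ alpha γ) atTop (𝓝 0) := by
    simpa [Real.zero_rpow (alpha_pos hγ).ne'] using
      (hε0.rpow_const (Or.inr (alpha_pos hγ).le)).const_mul (δ / 2)
  have hw : ∀ z ∈ Ω, Tendsto (fun k => v k z + δ / 2 * ε k ^ alpha γ) atTop (𝓝 (u z)) :=
    fun z hz => by simpa using (hlim.tendsto_at hz).add hshift
  have hinv : ∀ z ∈ Ω, Tendsto (fun k => profileInv γ A (v k z + δ / 2 * ε k ^ alpha γ))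
      atTop (𝓝 (profileInv γ A (u z))) :=
    fun z hz => ((continuous_profileInv hγ).tendsto _).comp (hw z hz)
  refine le_of_tendsto_of_tendsto (hinv y hyΩ) ((hinv x (hball hx)).add_const _) ?_
  filter_upwards [(hw y hyΩ).eventually (eventually_lt_nhds hy)] with k hk
  have hεk := hε k
  have hsuper : IsViscositySupersolution (fun s => 2 * s ^ (-γ)) (Metric.ball y ρ)
      fun z => v k z + δ / 2 * ε k ^ alpha γ :=
    have hsub := Metric.ball_subset_closedBall.trans hball
    (hv k).add_const hsub fun z hz => source_le hγ1 hδ hB hεk (hv0 k z (hsub hz))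
  exact hsuper.profileInv_le_add_dist hγ hA hAc (((hcont k).mono hball).add continuousOn_const)
    (fun z hz => add_pos_of_nonneg_of_pos (hv0 k z (hball hz)) (by positivity)) hk x hx

lemma le_mul_rpow (hu : IsSupersolutionLimit γ B Ω u) (hγ : -3 < γ) (hγ1 : γ ≤ 1)
    (hδ : 0 < δ) (hB : IsPenalization δ B) {A r ρ : ℝ} (hA : 1 ≤ A)
    (hAc : 2 < A ^ (3 + γ) * (alpha γ ^ 3 * (alpha γ - 1))) {x y : EuclideanSpace ℝ (Fin n)}
    (hball : Metric.closedBall y ρ ⊆ Ω) (hy : u y < A * ρ ^ alpha γ)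
    (hxy : dist x y ≤ r) (hr : r ≤ ρ) (hx : u x ≤ r ^ alpha γ) :
    u y ≤ A * 2 ^ alpha γ * r ^ alpha γ := by
  have hA0 : 0 < A := one_pos.trans_le hA
  have hr0 : 0 ≤ r := dist_nonneg.trans hxy
  have hx_mem : x ∈ Metric.closedBall y ρ := hxy.trans hr
  have hux : profileInv γ A (u x) ≤ r :=
    (profileInv_le_iff hγ hA0 (hu.nonneg x (hball hx_mem)) hr0).2
      (hx.trans (le_mul_of_one_le_left (by positivity) hA))
  have huy : profileInv γ A (u y) ≤ 2 * r := by
    linarith [hu.profileInv_le_add_dist hγ hγ1 hδ hB hA0 hAc hball hy hx_mem]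
  have hy_nonneg : 0 ≤ u y := hu.nonneg y (hball (Metric.mem_closedBall_self (hr0.trans hr)))
  rw [profileInv_le_iff hγ hA0 hy_nonneg (by positivity), Real.mul_rpow two_pos.le hr0,
    ← mul_assoc] at huy
  exact huy

end IsSupersolutionLimit

end Limit

end SingularInfinity

open SingularInfinity in
theorem proposition5p1_general {γ : ℝ} (hγ : -3 < γ) (hγ1 : γ < 1) (M : ℝ) {d : ℝ}
    (hd : 0 < d) :
    ∃ C r₀ : ℝ, 0 < C ∧ 0 < r₀ ∧
      ∀ (n : ℕ) (δ : ℝ) (B : ℝ → ℝ), 0 < δ → IsPenalization δ B →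
      ∀ (Ω : Set (EuclideanSpace ℝ (Fin n))) (u : EuclideanSpace ℝ (Fin n) → ℝ),
        IsSupersolutionLimit γ B Ω u → (∀ y ∈ Ω, u y ≤ M) →
      ∀ r : ℝ, r ≤ r₀ →
      ∀ x ∈ closure {y ∈ Ω | u y < r ^ alpha γ} ∩ Ω, (∀ y ∈ frontier Ω, d ≤ dist x y) →
        Metric.ball x r ⊆ Ω ∧ ∀ y ∈ Metric.ball x r, u y ≤ C * r ^ alpha γ := by
  obtain ⟨A, hA, hAc, hAM⟩ := exists_barrier_const hγ hγ1 2 M (half_pos hd)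
  refine ⟨A * 2 ^ alpha γ, d / 2, by positivity, half_pos hd, ?_⟩
  intro n δ B hδ hB Ω u hu huM r hr x ⟨hx_closure, hx⟩ hdist
  have hball : Metric.ball x d ⊆ Ω := ball_subset_of_le_dist_frontier hx hdist
  have hrd : r ≤ d := hr.trans (half_le_self hd.le)
  refine ⟨(Metric.ball_subset_ball hrd).trans hball, fun y hy => ?_⟩
  have hux : u x ≤ r ^ alpha γ :=
    ((hu.continuousOn x hx).mono (sep_subset _ _)).closure_le hx_closure
      continuousWithinAt_const fun z hz => hz.2.le
  have hy_ball : Metric.closedBall y (d / 2) ⊆ Metric.ball x d :=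
    Metric.closedBall_subset_ball' (by linarith [Metric.mem_ball.1 hy])
  exact hu.le_mul_rpow hγ hγ1.le hδ hB hA hAc (hy_ball.trans hball)
    ((huM y (hball (Metric.ball_subset_ball hrd hy))).trans_lt hAM)
    (Metric.mem_ball'.1 hy).le hr hux

theorem proposition5p1 (n : ℕ) (hn : 1 ≤ n) (γ : ℝ) (hγ0 : 0 ≤ γ) (hγ1 : γ < 1)
    (M d : ℝ) (hM : 0 ≤ M) (hd : 0 < d) :
    ∃ C r₀ : ℝ, 0 < C ∧ 0 < r₀ ∧
      ∀ (δ : ℝ) (B : ℝ → ℝ), 0 < δ → SingularInfinity.IsPenalization δ B →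
      ∀ Ω Ω' : Set (EuclideanSpace ℝ (Fin n)),
        IsOpen Ω → IsConnected Ω → Bornology.IsBounded Ω →
        IsOpen Ω' → IsConnected Ω' → closure Ω' ⊆ Ω →
        (∀ x ∈ Ω', ∀ y ∈ frontier Ω, d ≤ dist x y) →
      ∀ φ u : EuclideanSpace ℝ (Fin n) → ℝ,
        SingularInfinity.IsLimitSolution γ B Ω φ u →
        eLpNorm u ∞ (volume.restrict Ω) ≤ ENNReal.ofReal M →
      ∀ r : ℝ, 0 < r → r ≤ r₀ →
      ∀ x ∈ closure {y ∈ Ω | u y < r ^ SingularInfinity.alpha γ} ∩ Ω',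
        Metric.ball x r ⊆ Ω ∧
        ∀ y ∈ Metric.ball x r, u y ≤ C * r ^ SingularInfinity.alpha γ := by
  obtain ⟨C, r₀, hC, hr₀, hgrowth⟩ := proposition5p1_general (by linarith) hγ1 M hd
  refine ⟨C, r₀, hC, hr₀, fun δ B hδ hB Ω Ω' hΩ _ hΩb _ _ hΩ' hdist φ u hu hnorm r _ hr x hx => ?_⟩
  have hlim := hu.isSupersolutionLimit hn hδ hB hΩ hΩb
  exact hgrowth n δ B hδ hB Ω u hlim
    (SingularInfinity.le_of_eLpNorm_top_le hΩ hlim.continuousOn hM hnorm) r hr x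
    ⟨hx.1, hΩ' (subset_closure hx.2)⟩ (hdist x hx.2)
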